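/- Let $N\ge 0$ be an integer, $V_1,\dots,V_N\ge 0$ deterministic magnitudes and $\Omega>0$. In the multiple-waves plus diffuse power (MWDP) model the received signal is $$\tilde V=\sum_{i=1}^N V_i e^{j\phi_i}+V_d e^{j\phi_d},$$ where $\phi_1,\dots,\phi_N,\phi_d$ are uniformly distributed on $[0,2\pi]$, $V_d$ has the Rayleigh density $f_{V_d}(x)=\frac{2x}{\Omega}e^{-x^2/\Omega}$ for $x>0$ (the Nakagami density with shape parameter $m=1$ and spread parameter $\Omega$), and $\phi_1,\dots,\phi_N,\phi_d,V_d$ are mutually independent. Let $R=|\tilde V|$ be the envelope, and let $$\Psi_2(a;b_1,\dots,b_n;x_1,\dots,x_n)=\sum_{k_1,\dots,k_n\ge 0}\frac{(a)_{k_1+\dots+k_n}}{(b_1)_{k_1}\cdots(b_n)_{k_n}\,k_1!\cdots k_n!}\,x_1^{k_1}\cdots x_n^{k_n}$$ be the confluent hypergeometric series of $n$ variables, with $(a)_k=a(a+1)\cdots(a+k-1)$. Then the series below converge absolutely, $R$ has a probability density, and for $r,t\ge 0$ the density $f_R$ (up to equality almost everywhere; it vanishes on the negative half-line) and the distribution function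 $F_R$ of $R$ are $$f_R(r)=\frac{2r}{\Omega}\,\Psi_2\Big(1;\underbrace{1,\dots,1}_{N+1};-\frac{V_1^2}{\Omega},\dots,-\frac{V_N^2}{\Omega},-\frac{r^2}{\Omega}\Big),$$ $$F_R(t)=\frac{t^2}{\Omega}\,\Psi_2\Big(1;\underbrace{1,\dots,1}_{N},2;-\frac{V_1^2}{\Omega},\dots,-\frac{V_N^2}{\Omega},-\frac{t^2}{\Omega}\Big),$$ where the right-hand side for $f_R(r)$ is nonnegative for every $r\ge 0$. -/

import Mathlib

open MeasureTheory ProbabilityTheory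

/-- The Pochhammer symbol `(a)_k = a (a + 1) ⋯ (a + k - 1)`. -/
noncomputable def pochhammerSymbol (a : ℝ) (k : ℕ) : ℝ :=
  (ascPochhammer ℝ k).eval a

/-- The term with multi-index `k = (k_1, …, k_n)` of the confluent hypergeometric series
`Ψ₂(a; b_1, …, b_n; x_1, …, x_n)`. -/
noncomputable def psi2Term {n : ℕ} (a : ℝ) (b x : Fin n → ℝ) (k : Fin n → ℕ) : ℝ :=
  pochhammerSymbol a (∑ i, k i) /
      ((∏ i, pochhammerSymbol (b i) (k i)) * ∏ i, ((k i).factorial : ℝ)) *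
    ∏ i, x i ^ k i

/-- The confluent hypergeometric series of `n` variables
`Ψ₂(a; b_1, …, b_n; x_1, …, x_n)`, an `n`-fold infinite sum. -/
noncomputable def psi2 {n : ℕ} (a : ℝ) (b x : Fin n → ℝ) : ℝ :=
  ∑' k : Fin n → ℕ, psi2Term a b x k

/-- The Nakagami density with shape parameter `m` and spread parameter `Ω`. -/
noncomputable def nakagamiPDFReal (m Ω x : ℝ) : ℝ :=
  if 0 < x then
    2 / Real.Gamma m * (m / Ω) ^ m * x ^ (2 * m - 1) * Real.exp (-(m / Ω) * x ^ 2)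
  else 0

/-- The Nakagami distribution on the real line. -/
noncomputable def nakagamiMeasure (m Ω : ℝ) : Measure ℝ :=
  volume.withDensity fun x => ENNReal.ofReal (nakagamiPDFReal m Ω x)

/-- The random data of the multiple-waves model with generalized diffuse scatter: `N` specular
waves with deterministic magnitudes `V i` and random phases `φ i`, and a diffuse wave with
Nakagami distributed magnitude `Vd` (shape `m`, spread `Ω`) and phase `φd`. All phases are uniform
on `[0, 2π]`, and the phases and the diffuse magnitude are mutually independent. -/
structure IsMWGD {S : Type*} [MeasurableSpace S] (μ : Measure S) {N : ℕ} (m Ω : ℝ)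
    (V : Fin N → ℝ) (φ : Fin N → S → ℝ) (Vd φd : S → ℝ) : Prop where
  shape_pos : 0 < m
  spread_pos : 0 < Ω
  magnitude_nonneg : ∀ i, 0 ≤ V i
  phase_uniform : ∀ i, pdf.IsUniform (φ i) (Set.Icc 0 (2 * Real.pi)) μ volume
  diffuse_phase_uniform : pdf.IsUniform φd (Set.Icc 0 (2 * Real.pi)) μ volume
  diffuse_magnitude_law : HasLaw Vd (nakagamiMeasure m Ω) μ
  independent : iIndepFun (Sum.elim φ ![Vd, φd] : Fin N ⊕ Fin 2 → S → ℝ) μ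

/-- The multiple-waves plus diffuse power model: the case `m = 1`, in which the magnitude of the
diffuse wave is Rayleigh distributed. -/
def IsMWDP {S : Type*} [MeasurableSpace S] (μ : Measure S) {N : ℕ} (Ω : ℝ)
    (V : Fin N → ℝ) (φ : Fin N → S → ℝ) (Vd φd : S → ℝ) : Prop :=
  IsMWGD μ 1 Ω V φ Vd φd

/-- The received complex baseband signal `∑ i, V i * exp (j φ i) + Vd * exp (j φd)`. -/
noncomputable def receivedSignal {S : Type*} {N : ℕ} (V : Fin N → ℝ) (φ : Fin N → S → ℝ)
    (Vd φd : S → ℝ) (s : S) : ℂ :=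
  ∑ i, (V i : ℂ) * Complex.exp (Complex.I * φ i s) + (Vd s : ℂ) * Complex.exp (Complex.I * φd s)

/-- The envelope `R` of the received signal. -/
noncomputable def envelope {S : Type*} {N : ℕ} (V : Fin N → ℝ) (φ : Fin N → S → ℝ)
    (Vd φd : S → ℝ) (s : S) : ℝ :=
  ‖receivedSignal V φ Vd φd s‖

/-- The arguments `-V_1² / Ω, …, -V_N² / Ω, -t² / Ω`. -/
noncomputable def psi2Args {N : ℕ} (Ω : ℝ) (V : Fin N → ℝ) (t : ℝ) : Fin (N + 1) → ℝ :=
  Fin.snoc (α := fun _ => ℝ) (fun i => -(V i ^ 2 / Ω)) (-(t ^ 2 / Ω))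

/-- The lower parameters `1, …, 1, c`, with `N` ones. -/
def psi2Params (N : ℕ) (c : ℝ) : Fin (N + 1) → ℝ :=
  Fin.snoc (α := fun _ => ℝ) (fun _ => 1) c

/-! A Rayleigh magnitude with an independent uniform phase is a circular complex Gaussian
(`lintegral_rayleigh_phase`). Given the specular phases `θ`, the received signal is thus Gaussian
with mean `S = phasorSum V θ`, and in polar coordinates its modulus has density `2πr` times the
average over `α` of `(πΩ)⁻¹ exp(-|r e^{iα} - S|² / Ω)`. After averaging over `θ` too, the evaluation
point `r e^{iα}` acts as one more wave, of amplitude `-r`, next to the `N` specular ones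
(`lintegral_complexGaussianPDFReal_phase`).

It remains to average `exp(-|S|² / Ω)` over all phases of a phasor sum. Expanding the exponential,
Parseval (`integral_norm_phasorSum_pow`) gives the `2m`-th moment of `|S|` with coefficients `(m! /
∏ k_j!)²`; dividing by `m!` leaves `m! / ∏ (k_j!)²`, the coefficients of `Ψ₂(1; 1, …, 1)`
(`psi2_one_one_eq_integral`). The distribution function follows by termwise integration
(`integral_mul_psi2`). -/

/-! ### Uniform phases and moments of phasor sums. -/

/-- The uniform distribution on `[0, 2π]`. -/
noncomputable def phaseMeasure : Measure ℝ :=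
  ProbabilityTheory.cond volume (Set.Icc 0 (2 * Real.pi))

lemma phaseMeasure_eq_smul :
    phaseMeasure = (ENNReal.ofReal (2 * Real.pi))⁻¹ •
      volume.restrict (Set.Icc 0 (2 * Real.pi)) := by
  simp [phaseMeasure, ProbabilityTheory.cond, Real.volume_Icc]

instance : IsProbabilityMeasure phaseMeasure := by
  refine ProbabilityTheory.cond_isProbabilityMeasure_of_finite ?_ ?_
  · simp [Real.volume_Icc, Real.pi_pos]
  · rw [Real.volume_Icc]
    exact ENNReal.ofReal_ne_top

lemma integral_phaseMeasure (f : ℝ → ℂ) :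
    ∫ θ, f θ ∂phaseMeasure = (2 * Real.pi : ℂ)⁻¹ * ∫ θ in (0 : ℝ)..2 * Real.pi, f θ := by
  rw [phaseMeasure_eq_smul, integral_smul_measure, integral_Icc_eq_integral_Ioc,
    ← intervalIntegral.integral_of_le (by positivity), ENNReal.toReal_inv,
    ENNReal.toReal_ofReal (by positivity), Complex.real_smul]
  push_cast
  rfl

/-- Orthogonality of the characters of the circle, which leaves only diagonal terms in Parseval's
identity. -/
lemma integral_phaseMeasure_exp_pow_mul_conj (k l : ℕ) :
    ∫ θ : ℝ, Complex.exp (Complex.I * θ) ^ k *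
      (starRingEnd ℂ) (Complex.exp (Complex.I * θ) ^ l) ∂phaseMeasure = if k = l then 1 else 0 := by
  have hpi : (Real.pi : ℂ) ≠ 0 := by exact_mod_cast Real.pi_ne_zero
  have h : ∀ θ : ℝ, Complex.exp (Complex.I * θ) ^ k *
      (starRingEnd ℂ) (Complex.exp (Complex.I * θ) ^ l) =
      Complex.exp (((k : ℂ) - l) * Complex.I * θ) := by
    intro θ
    rw [← Complex.exp_nat_mul, ← Complex.exp_nat_mul, ← Complex.exp_conj, ← Complex.exp_add]
    congr 1
    simp
    ring
  simp_rw [h]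
  split_ifs with hkl
  · simp [hkl]
  · rw [integral_phaseMeasure, integral_exp_mul_complex]
    · have : ((k : ℂ) - l) * Complex.I * ((2 * Real.pi : ℝ) : ℂ) =
          ((k - l : ℤ) : ℂ) * (2 * Real.pi * Complex.I) := by
        push_cast; ring
      rw [this, Complex.exp_int_mul_two_pi_mul_I]
      simp
    · refine mul_ne_zero (sub_ne_zero.2 (by exact_mod_cast hkl)) Complex.I_ne_zero

/-- The superposition of waves with amplitudes `x` and phases `θ`. -/
noncomputable def phasorSum {n : ℕ} (x θ : Fin n → ℝ) : ℂ :=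
  ∑ j, (x j : ℂ) * Complex.exp (Complex.I * θ j)

lemma norm_phasorSum_le {n : ℕ} (x θ : Fin n → ℝ) : ‖phasorSum x θ‖ ≤ ∑ j, |x j| := by
  refine (norm_sum_le _ _).trans (Finset.sum_le_sum fun j _ => ?_)
  rw [norm_mul, mul_comm Complex.I, Complex.norm_exp_ofReal_mul_I]
  simp

lemma continuous_phasorSum {n : ℕ} (x : Fin n → ℝ) : Continuous (phasorSum x) := by
  unfold phasorSum
  fun_prop

/-- Parseval's identity for the powers of a superposition of waves. -/
lemma integral_norm_phasorSum_pow {n : ℕ} (x : Fin n → ℝ) (m : ℕ) :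
    ∫ θ, ‖phasorSum x θ‖ ^ (2 * m) ∂Measure.pi (fun _ : Fin n => phaseMeasure) =
      ∑ k ∈ Finset.piAntidiag Finset.univ m,
        (Nat.multinomial Finset.univ k : ℝ) ^ 2 * ∏ j, x j ^ (2 * k j) := by
  have hsq : ∀ θ, ((‖phasorSum x θ‖ ^ (2 * m) : ℝ) : ℂ) =
      ∑ k ∈ Finset.piAntidiag Finset.univ m, ∑ l ∈ Finset.piAntidiag Finset.univ m,
        ((Nat.multinomial Finset.univ k : ℂ) * Nat.multinomial Finset.univ l *
          ∏ j, (x j : ℂ) ^ (k j + l j)) *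
        ∏ j, (Complex.exp (Complex.I * θ j) ^ k j *
          (starRingEnd ℂ) (Complex.exp (Complex.I * θ j) ^ l j)) := by
    intro θ
    have : ((‖phasorSum x θ‖ ^ (2 * m) : ℝ) : ℂ) =
        phasorSum x θ ^ m * (starRingEnd ℂ) (phasorSum x θ ^ m) := by
      rw [Complex.mul_conj, Complex.normSq_eq_norm_sq, norm_pow]
      push_cast
      ring
    rw [this, phasorSum, Finset.sum_pow_eq_sum_piAntidiag, map_sum, Finset.sum_mul_sum]
    refine Finset.sum_congr rfl fun k _ => Finset.sum_congr rfl fun l _ => ?_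
    simp only [map_mul, map_prod, map_pow, Complex.conj_ofReal, map_natCast, mul_pow,
      Finset.prod_mul_distrib, pow_add]
    ring
  have hint : ∀ k l : Fin n → ℕ, Integrable (fun θ : Fin n → ℝ =>
      ∏ j, (Complex.exp (Complex.I * θ j) ^ k j *
          (starRingEnd ℂ) (Complex.exp (Complex.I * θ j) ^ l j)))
        (Measure.pi fun _ => phaseMeasure) := by
    intro k l
    refine Integrable.of_bound (C := 1) ?_ (Filter.Eventually.of_forall fun θ => ?_)
    · refine Continuous.aestronglyMeasurable ?_
      fun_prop
    · simp [norm_prod, mul_comm Complex.I, Complex.norm_exp_ofReal_mul_I]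
  have key : ((∫ θ, ‖phasorSum x θ‖ ^ (2 * m) ∂Measure.pi (fun _ : Fin n => phaseMeasure) : ℝ) : ℂ)
      = ((∑ k ∈ Finset.piAntidiag Finset.univ m,
        (Nat.multinomial Finset.univ k : ℝ) ^ 2 * ∏ j, x j ^ (2 * k j) : ℝ) : ℂ) := by
    rw [← integral_complex_ofReal]
    simp_rw [hsq]
    rw [integral_finsetSum _ fun k _ => integrable_finsetSum _ fun l _ => (hint k l).const_mul _]
    push_cast
    refine Finset.sum_congr rfl fun k hk => ?_
    rw [integral_finsetSum _ fun l _ => (hint k l).const_mul _]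
    have : ∀ l ∈ Finset.piAntidiag Finset.univ m, ∫ θ : Fin n → ℝ,
        ((Nat.multinomial Finset.univ k : ℂ) * Nat.multinomial Finset.univ l *
          ∏ j, (x j : ℂ) ^ (k j + l j)) *
        ∏ j, (Complex.exp (Complex.I * θ j) ^ k j *
          (starRingEnd ℂ) (Complex.exp (Complex.I * θ j) ^ l j))
          ∂Measure.pi (fun _ : Fin n => phaseMeasure) =
        if k = l then (Nat.multinomial Finset.univ k : ℂ) ^ 2 * ∏ j, (x j : ℂ) ^ (2 * k j)
          else 0 := by
      intro l _
      rw [integral_const_mul, integral_fintype_prod_eq_prod (fun j (t : ℝ) =>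
        Complex.exp (Complex.I * t) ^ k j * (starRingEnd ℂ) (Complex.exp (Complex.I * t) ^ l j))]
      simp_rw [integral_phaseMeasure_exp_pow_mul_conj]
      split_ifs with hkl
      · subst hkl
        simp [two_mul, sq]
      · obtain ⟨j, hj⟩ := Function.ne_iff.1 hkl
        rw [Finset.prod_eq_zero (i := j) (f := fun j => if k j = l j then (1 : ℂ) else 0)
          (Finset.mem_univ j) (if_neg hj), mul_zero]
    rw [Finset.sum_congr rfl this, Finset.sum_ite_eq, if_pos hk]
  exact_mod_cast key

/-! ### The series `Ψ₂(1; 1, …, 1)`: convergence and Gaussian average. -/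

lemma pochhammerSymbol_one (k : ℕ) : pochhammerSymbol 1 k = k.factorial := by
  simp [pochhammerSymbol, ascPochhammer_eval_one]

lemma pochhammerSymbol_two (k : ℕ) : pochhammerSymbol 2 k = (k + 1).factorial := by
  have h := ascPochhammer_nat_eq_natCast_ascFactorial ℝ 2 k
  have h2 := Nat.factorial_mul_ascFactorial 1 k
  rw [Nat.cast_ofNat] at h
  rw [pochhammerSymbol, h, add_comm k 1, ← h2]
  simp

/-- The terms of `Ψ₂(1; 1, …, 1; -x_1² / Ω, …, -x_n² / Ω)` in multinomial form. -/
lemma psi2Term_one_one {n : ℕ} (Ω : ℝ) (x : Fin n → ℝ) (k : Fin n → ℕ) :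
    psi2Term 1 (fun _ => 1) (fun j => -(x j ^ 2 / Ω)) k =
      (-Ω⁻¹) ^ (∑ j, k j) / (∑ j, k j).factorial *
        ((Nat.multinomial Finset.univ k : ℝ) ^ 2 * ∏ j, x j ^ (2 * k j)) := by
  have hspec : (∏ j, ((k j).factorial : ℝ)) * Nat.multinomial Finset.univ k =
      (∑ j, k j).factorial := by
    exact_mod_cast Nat.multinomial_spec Finset.univ k
  have hprod : ∏ j, (-(x j ^ 2 / Ω)) ^ k j = (-Ω⁻¹) ^ (∑ j, k j) * ∏ j, x j ^ (2 * k j) := by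
    rw [← Finset.prod_pow_eq_pow_sum, ← Finset.prod_mul_distrib]
    refine Finset.prod_congr rfl fun j _ => ?_
    rw [pow_mul, ← mul_pow]
    ring
  have h0 : (∏ j, ((k j).factorial : ℝ)) ≠ 0 :=
    Finset.prod_ne_zero_iff.2 fun j _ => by positivity
  have h1 : ((∑ j, k j).factorial : ℝ) ≠ 0 := by positivity
  simp only [psi2Term, pochhammerSymbol_one, hprod]
  rw [← hspec] at h1 ⊢
  field_simp

/-- Regrouping by total degree, with finite fibres, makes the multiple series comparable with the
power series of the exponential. -/
lemma hasSum_piAntidiag_of_hasSum {n : ℕ} {f : (Fin n → ℕ) → ℝ} {a : ℝ} (hf : HasSum f a) :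
    HasSum (fun m => ∑ k ∈ Finset.piAntidiag Finset.univ m, f k) a := by
  have h := hf.tsum_fiberwise (fun k => ∑ j, k j)
  have hset : ∀ m, (fun k : Fin n → ℕ => ∑ j, k j) ⁻¹' {m} =
      (Finset.piAntidiag (Finset.univ : Finset (Fin n)) m : Set (Fin n → ℕ)) := by
    intro m
    ext k
    simp
  have htsum : ∀ m, ∑' k : (fun k : Fin n → ℕ => ∑ j, k j) ⁻¹' {m}, f k =
      ∑ k ∈ Finset.piAntidiag Finset.univ m, f k := by
    intro m
    rw [hset, Finset.tsum_subtype']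
  exact (funext htsum) ▸ h

/-- Any finite set of multi-indices lies in finitely many degree blocks, so nonnegativity bounds all
partial sums. -/
lemma summable_of_piAntidiag {n : ℕ} {f : (Fin n → ℕ) → ℝ} (h0 : ∀ k, 0 ≤ f k)
    (hf : Summable fun m => ∑ k ∈ Finset.piAntidiag Finset.univ m, f k) : Summable f := by
  classical
  refine summable_of_sum_le (c := ∑' m, ∑ k ∈ Finset.piAntidiag Finset.univ m, f k) h0 fun u => ?_
  calc ∑ k ∈ u, f k = ∑ m ∈ u.image (fun k => ∑ j, k j), ∑ k ∈ u with ∑ j, k j = m, f k :=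
        (Finset.sum_fiberwise_of_maps_to (fun k hk => Finset.mem_image_of_mem _ hk) _).symm
    _ ≤ ∑ m ∈ u.image (fun k => ∑ j, k j), ∑ k ∈ Finset.piAntidiag Finset.univ m, f k := by
        refine Finset.sum_le_sum fun m _ => Finset.sum_le_sum_of_subset_of_nonneg ?_
          fun k _ _ => h0 k
        intro k hk
        simpa using (Finset.mem_filter.1 hk).2
    _ ≤ _ := hf.sum_le_tsum _ fun m _ => Finset.sum_nonneg fun k _ => h0 k

/-- By Parseval the sum is a moment of a modulus that never exceeds `∑ j, |x j|`, so no
combinatorial estimate is needed. -/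
lemma sum_multinomial_sq_mul_le {n : ℕ} (x : Fin n → ℝ) (m : ℕ) :
    ∑ k ∈ Finset.piAntidiag Finset.univ m,
        (Nat.multinomial Finset.univ k : ℝ) ^ 2 * ∏ j, x j ^ (2 * k j) ≤
      ((∑ j, |x j|) ^ 2) ^ m := by
  rw [← integral_norm_phasorSum_pow]
  calc _ ≤ ∫ _θ, (∑ j, |x j|) ^ (2 * m) ∂Measure.pi (fun _ : Fin n => phaseMeasure) := by
        refine integral_mono_of_nonneg (Filter.Eventually.of_forall fun θ => by positivity)
          (integrable_const _) (Filter.Eventually.of_forall fun θ => ?_)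
        exact pow_le_pow_left₀ (norm_nonneg _) (norm_phasorSum_le x θ) _
    _ = _ := by simp [pow_mul]

/-- The absolute degree-`m` block is dominated by the `m`-th term of an exponential series. -/
lemma summable_psi2Term_one_one {n : ℕ} (Ω : ℝ) (x : Fin n → ℝ) :
    Summable (psi2Term 1 (fun _ => 1) (fun j => -(x j ^ 2 / Ω))) := by
  refine Summable.of_norm (summable_of_piAntidiag (fun k => norm_nonneg _) ?_)
  refine Summable.of_nonneg_of_le (fun m => Finset.sum_nonneg fun k _ => norm_nonneg _)
    (fun m => ?_) (Real.summable_pow_div_factorial (|Ω⁻¹| * (∑ j, |x j|) ^ 2))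
  calc ∑ k ∈ Finset.piAntidiag Finset.univ m,
        ‖psi2Term 1 (fun _ => 1) (fun j => -(x j ^ 2 / Ω)) k‖
      = |Ω⁻¹| ^ m / m.factorial * ∑ k ∈ Finset.piAntidiag Finset.univ m,
          (Nat.multinomial Finset.univ k : ℝ) ^ 2 * ∏ j, x j ^ (2 * k j) := by
        rw [Finset.mul_sum]
        refine Finset.sum_congr rfl fun k hk => ?_
        have hk' : ∑ j, k j = m := by simpa using hk
        have hn : 0 ≤ ∏ j, x j ^ (2 * k j) :=
          Finset.prod_nonneg fun j _ => (even_two_mul _).pow_nonneg _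
        rw [psi2Term_one_one, hk', Real.norm_eq_abs, abs_mul, abs_div, abs_pow, abs_neg,
          Nat.abs_cast, abs_of_nonneg (mul_nonneg (sq_nonneg _) hn)]
    _ ≤ |Ω⁻¹| ^ m / m.factorial * ((∑ j, |x j|) ^ 2) ^ m := by
        gcongr
        exact sum_multinomial_sq_mul_le x m
    _ = _ := by rw [mul_pow]; ring

/-- `Ψ₂(1; 1, …, 1; -x_1² / Ω, …, -x_n² / Ω)` is an average of a Gaussian over all phases. -/
lemma psi2_one_one_eq_integral {n : ℕ} (Ω : ℝ) (x : Fin n → ℝ) :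
    psi2 1 (fun _ => 1) (fun j => -(x j ^ 2 / Ω)) =
      ∫ θ, Real.exp (-(‖phasorSum x θ‖ ^ 2 / Ω)) ∂Measure.pi (fun _ : Fin n => phaseMeasure) := by
  set P := Measure.pi (fun _ : Fin n => phaseMeasure)
  have hcont := continuous_phasorSum x
  have hbound : ∀ (m : ℕ) (θ : Fin n → ℝ),
      ‖(-Ω⁻¹) ^ m / m.factorial * ‖phasorSum x θ‖ ^ (2 * m)‖ ≤
        (|Ω⁻¹| * (∑ j, |x j|) ^ 2) ^ m / m.factorial := by
    intro m θ
    rw [Real.norm_eq_abs, abs_mul, abs_div, abs_pow, abs_neg, Nat.abs_cast, abs_pow, abs_norm,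
      mul_pow, ← pow_mul, mul_div_right_comm]
    gcongr
    exact norm_phasorSum_le x θ
  have hint : ∀ m : ℕ, Integrable
      (fun θ => (-Ω⁻¹) ^ m / m.factorial * ‖phasorSum x θ‖ ^ (2 * m)) P := fun m =>
    Integrable.of_bound (Continuous.aestronglyMeasurable (by fun_prop)) _
      (Filter.Eventually.of_forall (hbound m))
  have h1 : HasSum (fun m => ∫ θ, (-Ω⁻¹) ^ m / m.factorial * ‖phasorSum x θ‖ ^ (2 * m) ∂P)
      (∫ θ, ∑' m : ℕ, (-Ω⁻¹) ^ m / m.factorial * ‖phasorSum x θ‖ ^ (2 * m) ∂P) := by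
    refine hasSum_integral_of_summable_integral_norm hint ?_
    refine Summable.of_nonneg_of_le (fun m => integral_nonneg fun θ => norm_nonneg _)
      (fun m => ?_) (Real.summable_pow_div_factorial (|Ω⁻¹| * (∑ j, |x j|) ^ 2))
    calc _ ≤ ∫ _θ, (|Ω⁻¹| * (∑ j, |x j|) ^ 2) ^ m / m.factorial ∂P :=
          integral_mono (hint m).norm (integrable_const _) (hbound m)
      _ = _ := by simp
  have h2 := hasSum_piAntidiag_of_hasSum (summable_psi2Term_one_one Ω x).hasSum
  have h3 : ∀ θ, ∑' m : ℕ, (-Ω⁻¹) ^ m / m.factorial * ‖phasorSum x θ‖ ^ (2 * m) =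
      Real.exp (-(‖phasorSum x θ‖ ^ 2 / Ω)) := by
    intro θ
    rw [Real.exp_eq_exp_ℝ, NormedSpace.exp_eq_tsum_div]
    refine tsum_congr fun m => ?_
    rw [pow_mul, div_mul_eq_mul_div, ← mul_pow]
    congr 2
    ring
  simp_rw [h3] at h1
  rw [psi2]
  -- `Ψ₂` grouped by degree and the exponential series averaged term by term have the same `m`-th
  -- term.
  refine h2.unique ?_
  convert h1 using 2 with m
  rw [integral_const_mul, integral_norm_phasorSum_pow, Finset.mul_sum]
  refine Finset.sum_congr rfl fun k hk => ?_
  have hk' : ∑ j, k j = m := by simpa using hk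
  rw [psi2Term_one_one, hk']

/-! ### Polar coordinates and the diffuse wave. -/

/-- Reconciles phases on `[0, 2π]` with the polar angle on `(-π, π)`: both are fundamental domains
up to null sets. -/
lemma lintegral_phaseMeasure_of_periodic {f : ℝ → ENNReal}
    (hper : Function.Periodic f (2 * Real.pi)) :
    ∫⁻ θ, f θ ∂phaseMeasure =
      (ENNReal.ofReal (2 * Real.pi))⁻¹ * ∫⁻ θ in Set.Ioo (-Real.pi) Real.pi, f θ := by
  have hpos : (0 : ℝ) < 2 * Real.pi := by positivity
  have h := (isAddFundamentalDomain_Ioc hpos 0).setLIntegral_eq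
    (isAddFundamentalDomain_Ioc hpos (-Real.pi)) f hper.map_vadd_zmultiples
  rw [phaseMeasure_eq_smul, lintegral_smul_measure, smul_eq_mul]
  congr 1
  rw [setLIntegral_congr Ioc_ae_eq_Icc.symm, setLIntegral_congr Ioo_ae_eq_Ioc]
  rw [zero_add, show -Real.pi + 2 * Real.pi = Real.pi by ring] at h
  exact h

/-- The weight is the Jacobian `r` times the `2π` that undoes the normalization of `phaseMeasure`.
-/
lemma Complex.lintegral_eq_lintegral_phaseMeasure {f : ℂ → ENNReal} (hf : Measurable f) :
    ∫⁻ z, f z = ∫⁻ r in Set.Ioi (0 : ℝ), ENNReal.ofReal (2 * Real.pi * r) *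
      ∫⁻ θ, f (r * Complex.exp (Complex.I * θ)) ∂phaseMeasure := by
  have hpi : ENNReal.ofReal (2 * Real.pi) ≠ 0 := by simp [Real.pi_pos]
  have hsymm : ∀ p : ℝ × ℝ,
      Complex.polarCoord.symm p = p.1 * Complex.exp (Complex.I * p.2) := by
    intro p
    rw [Complex.polarCoord_symm_apply, mul_comm Complex.I, Complex.exp_mul_I,
      Complex.ofReal_cos, Complex.ofReal_sin]
  rw [← Complex.lintegral_comp_polarCoord_symm, polarCoord_target]
  simp_rw [hsymm, smul_eq_mul]
  rw [Measure.volume_eq_prod, ← Measure.prod_restrict, lintegral_prod _ (by fun_prop)]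
  refine lintegral_congr fun r => ?_
  dsimp only
  rw [lintegral_const_mul _ (by fun_prop), lintegral_phaseMeasure_of_periodic,
    ENNReal.ofReal_mul (by positivity), ← mul_assoc, mul_right_comm _ (ENNReal.ofReal r),
    ENNReal.mul_inv_cancel hpi ENNReal.ofReal_ne_top, one_mul]
  intro θ
  dsimp only
  rw [Complex.ofReal_add, mul_add, Complex.exp_add, Complex.ofReal_mul, Complex.ofReal_ofNat, mul_comm Complex.I (2 * _), Complex.exp_two_pi_mul_I, mul_one]

lemma nakagamiPDFReal_one (Ω x : ℝ) :
    nakagamiPDFReal 1 Ω x = if 0 < x then 2 * x / Ω * Real.exp (-(x ^ 2 / Ω)) else 0 := by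
  unfold nakagamiPDFReal
  split_ifs with h
  · rw [Real.Gamma_one, Real.rpow_one, show (2 * 1 - 1 : ℝ) = 1 by norm_num, Real.rpow_one]
    ring_nf
  · rfl

lemma lintegral_nakagamiMeasure_one (Ω : ℝ) (f : ℝ → ENNReal) :
    ∫⁻ v, f v ∂nakagamiMeasure 1 Ω =
      ∫⁻ v in Set.Ioi 0, ENNReal.ofReal (2 * v / Ω * Real.exp (-(v ^ 2 / Ω))) * f v := by
  have hmeas : Measurable fun x => ENNReal.ofReal (nakagamiPDFReal 1 Ω x) := by
    simp_rw [nakagamiPDFReal_one]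
    exact (Measurable.ite measurableSet_Ioi (by fun_prop) measurable_const).ennreal_ofReal
  rw [nakagamiMeasure, lintegral_withDensity_eq_lintegral_mul_non_measurable _ hmeas
    (Filter.Eventually.of_forall fun _ => ENNReal.ofReal_lt_top),
    ← lintegral_indicator measurableSet_Ioi]
  refine lintegral_congr fun x => ?_
  rw [Pi.mul_apply, nakagamiPDFReal_one]
  by_cases hx : 0 < x
  · simp [hx]
  · simp [hx]

/-- The density of the circular complex Gaussian distribution with mean power `Ω`. -/
noncomputable def complexGaussianPDFReal (Ω : ℝ) (z : ℂ) : ℝ :=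
  (Real.pi * Ω)⁻¹ * Real.exp (-(‖z‖ ^ 2 / Ω))

lemma continuous_complexGaussianPDFReal (Ω : ℝ) : Continuous (complexGaussianPDFReal Ω) := by
  unfold complexGaussianPDFReal
  fun_prop

/-- A wave with Rayleigh magnitude and independent uniform phase is complex Gaussian. -/
lemma lintegral_rayleigh_phase {Ω : ℝ} (hΩ : 0 < Ω) {g : ℂ → ENNReal} (hg : Measurable g) :
    ∫⁻ v, ∫⁻ θ, g (v * Complex.exp (Complex.I * θ)) ∂phaseMeasure ∂nakagamiMeasure 1 Ω =
      ∫⁻ z, ENNReal.ofReal (complexGaussianPDFReal Ω z) * g z := by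
  have hρ := (continuous_complexGaussianPDFReal Ω).measurable
  rw [lintegral_nakagamiMeasure_one, Complex.lintegral_eq_lintegral_phaseMeasure (by fun_prop)]
  refine setLIntegral_congr_fun measurableSet_Ioi fun v hv => ?_
  have hv : 0 < v := hv
  have h : ∀ θ : ℝ, complexGaussianPDFReal Ω (v * Complex.exp (Complex.I * θ)) =
      (Real.pi * Ω)⁻¹ * Real.exp (-(v ^ 2 / Ω)) := by
    intro θ
    rw [complexGaussianPDFReal, norm_mul, mul_comm Complex.I, Complex.norm_exp_ofReal_mul_I,
      mul_one, Complex.norm_real, Real.norm_eq_abs, sq_abs]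
  simp_rw [h]
  rw [lintegral_const_mul _ (by fun_prop), ← mul_assoc, ← ENNReal.ofReal_mul (by positivity)]
  congr 2
  field_simp

/-- The distribution of the modulus of a complex Gaussian with random mean `phasorSum V θ`. -/
lemma lintegral_norm_phasorSum_add {N : ℕ} {Ω : ℝ} (hΩ : 0 < Ω) (V : Fin N → ℝ)
    {h : ℝ → ENNReal} (hh : Measurable h) :
    ∫⁻ θ, ∫⁻ v, ∫⁻ α, h ‖phasorSum V θ + v * Complex.exp (Complex.I * α)‖
        ∂phaseMeasure ∂nakagamiMeasure 1 Ω ∂Measure.pi (fun _ : Fin N => phaseMeasure) =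
      ∫⁻ r in Set.Ioi (0 : ℝ), ENNReal.ofReal (2 * Real.pi * r) *
        (∫⁻ θ, ∫⁻ α, ENNReal.ofReal
            (complexGaussianPDFReal Ω (r * Complex.exp (Complex.I * α) - phasorSum V θ))
          ∂phaseMeasure ∂Measure.pi (fun _ : Fin N => phaseMeasure)) * h r := by
  have hρ := (continuous_complexGaussianPDFReal Ω).measurable
  have hS := (continuous_phasorSum V).measurable
  have hinner : ∀ θ, ∫⁻ v, ∫⁻ α, h ‖phasorSum V θ + v * Complex.exp (Complex.I * α)‖
        ∂phaseMeasure ∂nakagamiMeasure 1 Ω =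
      ∫⁻ r in Set.Ioi (0 : ℝ), ENNReal.ofReal (2 * Real.pi * r) *
        (∫⁻ α, ENNReal.ofReal
            (complexGaussianPDFReal Ω (r * Complex.exp (Complex.I * α) - phasorSum V θ))
          ∂phaseMeasure) * h r := by
    intro θ
    -- Translation invariance moves the mean from the test function into the Gaussian density.
    rw [lintegral_rayleigh_phase hΩ (g := fun z => h ‖phasorSum V θ + z‖) (by fun_prop),
      ← lintegral_sub_right_eq_self _ (phasorSum V θ)]
    simp only [add_sub_cancel]
    rw [Complex.lintegral_eq_lintegral_phaseMeasure (by fun_prop)]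
    refine setLIntegral_congr_fun measurableSet_Ioi fun r hr => ?_
    have hr : 0 < r := hr
    rw [mul_assoc (ENNReal.ofReal _), ← lintegral_mul_const _ (by fun_prop)]
    congr 1
    refine lintegral_congr fun α => ?_
    rw [norm_mul, mul_comm Complex.I, Complex.norm_exp_ofReal_mul_I, mul_one, Complex.norm_real,
      Real.norm_of_nonneg hr.le]
  simp_rw [hinner]
  have hmeas : Measurable fun p : (Fin N → ℝ) × ℝ => ∫⁻ α, ENNReal.ofReal
      (complexGaussianPDFReal Ω (p.2 * Complex.exp (Complex.I * α) - phasorSum V p.1))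
        ∂phaseMeasure := by
    refine Measurable.lintegral_prod_right' (f := fun q : ((Fin N → ℝ) × ℝ) × ℝ =>
      ENNReal.ofReal (complexGaussianPDFReal Ω
        (q.1.2 * Complex.exp (Complex.I * q.2) - phasorSum V q.1.1))) ?_
    fun_prop
  have hswap : ∀ G : (Fin N → ℝ) × ℝ → ENNReal, Measurable G →
      ∫⁻ θ, (∫⁻ r in Set.Ioi (0 : ℝ), ENNReal.ofReal (2 * Real.pi * r) * G (θ, r) * h r)
        ∂Measure.pi (fun _ : Fin N => phaseMeasure) =
      ∫⁻ r in Set.Ioi (0 : ℝ), ENNReal.ofReal (2 * Real.pi * r) *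
        (∫⁻ θ, G (θ, r) ∂Measure.pi (fun _ : Fin N => phaseMeasure)) * h r := by
    intro G hG
    rw [lintegral_lintegral_swap (Measurable.aemeasurable (by unfold Function.uncurry; fun_prop))]
    refine lintegral_congr fun r => ?_
    rw [lintegral_mul_const _ (by fun_prop), lintegral_const_mul _ (by fun_prop)]
  exact hswap _ hmeas

/-! ### The evaluation point as an extra wave. -/

/-- Squaring hides the sign of the last amplitude; `-t` is chosen so that the phasor sum becomes the
difference `S - t e^{iα}`. -/
lemma psi2Args_eq {N : ℕ} (Ω : ℝ) (V : Fin N → ℝ) (t : ℝ) :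
    psi2Args Ω V t =
      fun j => -((Fin.snoc V (-t) : Fin (N + 1) → ℝ) j ^ 2 / Ω) := by
  ext j
  refine Fin.lastCases ?_ (fun i => ?_) j <;> simp [psi2Args]

lemma psi2Params_one (N : ℕ) : psi2Params N 1 = fun _ => 1 := by
  ext j
  refine Fin.lastCases ?_ (fun i => ?_) j <;> simp [psi2Params]

lemma lintegral_complexGaussianPDFReal_phase {N : ℕ} {Ω : ℝ} (hΩ : 0 < Ω) (V : Fin N → ℝ)
    (r : ℝ) :
    ∫⁻ θ, ∫⁻ α, ENNReal.ofReal
        (complexGaussianPDFReal Ω (r * Complex.exp (Complex.I * α) - phasorSum V θ))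
      ∂phaseMeasure ∂Measure.pi (fun _ : Fin N => phaseMeasure) =
    ENNReal.ofReal ((Real.pi * Ω)⁻¹ * psi2 1 (psi2Params N 1) (psi2Args Ω V r)) := by
  have hρ := (continuous_complexGaussianPDFReal Ω).measurable
  have hS := (continuous_phasorSum V).measurable
  rw [psi2Params_one, psi2Args_eq, psi2_one_one_eq_integral, ← integral_const_mul,
    ofReal_integral_eq_lintegral_ofReal]
  -- The last of the `N + 1` phases is split off and becomes the inner variable `α`.
  · rw [← (measurePreserving_piFinSuccAbove (fun _ : Fin (N + 1) => phaseMeasure)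
      (Fin.last N)).symm.lintegral_comp_emb (MeasurableEquiv.measurableEmbedding _),
      lintegral_prod_symm _ (by
        refine Measurable.aemeasurable ?_
        have := continuous_phasorSum (Fin.snoc V (-r) : Fin (N + 1) → ℝ)
        refine Measurable.comp (g := fun θ => ENNReal.ofReal ((Real.pi * Ω)⁻¹ *
          Real.exp (-(‖phasorSum (Fin.snoc V (-r) : Fin (N + 1) → ℝ) θ‖ ^ 2 / Ω)))) ?_
          (MeasurableEquiv.measurable _)
        fun_prop)]
    refine lintegral_congr fun θ => lintegral_congr fun α => ?_
    rw [complexGaussianPDFReal, norm_sub_rev]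
    congr 6
    simp [phasorSum, Fin.sum_univ_castSucc, sub_eq_add_neg, MeasurableEquiv.piFinSuccAbove]
  · refine Integrable.const_mul (Integrable.of_bound (C := 1) ?_ ?_) _
    · have := continuous_phasorSum (Fin.snoc V (-r) : Fin (N + 1) → ℝ)
      exact Continuous.aestronglyMeasurable (by fun_prop)
    · refine Filter.Eventually.of_forall fun θ => ?_
      rw [Real.norm_of_nonneg (Real.exp_nonneg _), Real.exp_le_one_iff]
      exact neg_nonpos.2 (by positivity)
  · exact Filter.Eventually.of_forall fun θ => by positivity

/-! ### Termwise integration of the density series. -/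

/-- Since `(2)_k = (k + 1) (1)_k`, raising the last parameter to `2` supplies the factor produced by
integrating `2 r^(2k+1)`. -/
lemma psi2Term_params_two {N : ℕ} (Ω : ℝ) (V : Fin N → ℝ) (t : ℝ) (k : Fin (N + 1) → ℕ) :
    psi2Term 1 (psi2Params N 2) (psi2Args Ω V t) k =
      psi2Term 1 (psi2Params N 1) (psi2Args Ω V t) k / (k (Fin.last N) + 1) := by
  simp only [psi2Term, psi2Params, Fin.prod_univ_castSucc, Fin.snoc_castSucc, Fin.snoc_last,
    pochhammerSymbol_one, pochhammerSymbol_two, Nat.factorial_succ]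
  push_cast
  have : (k (Fin.last N) + 1 : ℝ) ≠ 0 := by positivity
  have h1 : ∏ i : Fin N, ((k i.castSucc).factorial : ℝ) ≠ 0 :=
    Finset.prod_ne_zero_iff.2 fun j _ => by positivity
  field_simp

lemma summable_psi2Term_params_one {N : ℕ} (Ω : ℝ) (V : Fin N → ℝ) (t : ℝ) :
    Summable (psi2Term 1 (psi2Params N 1) (psi2Args Ω V t)) := by
  rw [psi2Params_one, psi2Args_eq]
  exact summable_psi2Term_one_one _ _

lemma summable_psi2Term_params_two {N : ℕ} (Ω : ℝ) (V : Fin N → ℝ) (t : ℝ) :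
    Summable (psi2Term 1 (psi2Params N 2) (psi2Args Ω V t)) := by
  refine Summable.of_norm_bounded (summable_psi2Term_params_one Ω V t).norm fun k => ?_
  rw [psi2Term_params_two, norm_div]
  refine div_le_self (norm_nonneg _) ?_
  rw [Real.norm_of_nonneg (by positivity)]
  linarith [(Nat.cast_nonneg (k (Fin.last N)) : (0 : ℝ) ≤ _)]

/-- The signs of the terms hide this; the Gaussian average shows it. -/
lemma psi2_params_one_nonneg {N : ℕ} (Ω : ℝ) (V : Fin N → ℝ) (t : ℝ) :
    0 ≤ psi2 1 (psi2Params N 1) (psi2Args Ω V t) := by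
  rw [psi2Params_one, psi2Args_eq, psi2_one_one_eq_integral]
  exact integral_nonneg fun θ => (Real.exp_pos _).le

/-- The dependence of the terms of `Ψ₂` on the last argument. -/
lemma psi2Term_psi2Args {N : ℕ} (a : ℝ) (b : Fin (N + 1) → ℝ) (Ω : ℝ) (V : Fin N → ℝ) (t : ℝ)
    (k : Fin (N + 1) → ℕ) :
    psi2Term a b (psi2Args Ω V t) k =
      psi2Term a b (psi2Args Ω V 1) k * t ^ (2 * k (Fin.last N)) := by
  simp only [psi2Term, psi2Args, Fin.prod_univ_castSucc, Fin.snoc_castSucc, Fin.snoc_last]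
  rw [pow_mul, show -(t ^ 2 / Ω) = -(1 ^ 2 / Ω) * t ^ 2 by ring, mul_pow]
  ring

lemma integral_mul_psi2Term {N : ℕ} (Ω : ℝ) (V : Fin N → ℝ) (t : ℝ) (k : Fin (N + 1) → ℕ) :
    ∫ r in (0 : ℝ)..t, 2 * r / Ω * psi2Term 1 (psi2Params N 1) (psi2Args Ω V r) k =
      t ^ 2 / Ω * psi2Term 1 (psi2Params N 2) (psi2Args Ω V t) k := by
  have h : ∀ r : ℝ, 2 * r / Ω * psi2Term 1 (psi2Params N 1) (psi2Args Ω V r) k =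
      2 / Ω * psi2Term 1 (psi2Params N 1) (psi2Args Ω V 1) k * r ^ (2 * k (Fin.last N) + 1) := by
    intro r
    rw [psi2Term_psi2Args]
    ring
  simp_rw [h]
  rw [intervalIntegral.integral_const_mul, integral_pow, psi2Term_params_two,
    psi2Term_psi2Args _ _ _ _ t]
  have : (k (Fin.last N) + 1 : ℝ) ≠ 0 := by positivity
  rw [zero_pow (by omega), show ((2 * k (Fin.last N) + 1 : ℕ) : ℝ) + 1 =
    2 * (k (Fin.last N) + 1) by push_cast; ring]
  field_simp
  ring

lemma integral_mul_psi2 {N : ℕ} (Ω : ℝ) (V : Fin N → ℝ) {t : ℝ} (ht : 0 ≤ t) :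
    ∫ r in (0 : ℝ)..t, 2 * r / Ω * psi2 1 (psi2Params N 1) (psi2Args Ω V r) =
      t ^ 2 / Ω * psi2 1 (psi2Params N 2) (psi2Args Ω V t) := by
  have hsum : HasSum
      (fun k => ∫ r in (0 : ℝ)..t, 2 * r / Ω * psi2Term 1 (psi2Params N 1) (psi2Args Ω V r) k)
      (∫ r in (0 : ℝ)..t, 2 * r / Ω * psi2 1 (psi2Params N 1) (psi2Args Ω V r)) := by
    -- Each term is a constant times a power of `r`, so on `(0, t]` its absolute value is at most
    -- that at `r = t`.
    refine intervalIntegral.hasSum_integral_of_dominated_convergence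
      (fun k _ => |2 * t / Ω| * |psi2Term 1 (psi2Params N 1) (psi2Args Ω V t) k|) ?_ ?_ ?_ ?_ ?_
    · intro k
      rw [funext fun r => congrArg (2 * r / Ω * ·)
        (psi2Term_psi2Args 1 (psi2Params N 1) Ω V r k)]
      exact Continuous.aestronglyMeasurable (by fun_prop)
    · intro k
      refine Filter.Eventually.of_forall fun r hr => ?_
      rw [Set.uIoc_of_le ht] at hr
      rw [psi2Term_psi2Args _ _ _ _ r, psi2Term_psi2Args _ _ _ _ t]
      simp only [Real.norm_eq_abs, abs_mul, abs_div, abs_pow, abs_of_pos hr.1, abs_of_nonneg ht]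
      have := hr.1
      gcongr <;> exact hr.2
    · exact Filter.Eventually.of_forall fun r _ =>
        (summable_psi2Term_params_one Ω V t).abs.mul_left _
    · exact intervalIntegrable_const
    · exact Filter.Eventually.of_forall fun r _ =>
        (summable_psi2Term_params_one Ω V r).hasSum.mul_left _
  simp_rw [integral_mul_psi2Term] at hsum
  exact hsum.unique ((summable_psi2Term_params_two Ω V t).hasSum.mul_left _)

/-- Measurability is read off the integral of a jointly continuous function, not off the series. -/
lemma measurable_psi2_one_one {n : ℕ} (Ω : ℝ) :
    Measurable fun x : Fin n → ℝ => psi2 1 (fun _ => 1) (fun j => -(x j ^ 2 / Ω)) := by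
  simp_rw [psi2_one_one_eq_integral]
  have h : Continuous fun p : (Fin n → ℝ) × (Fin n → ℝ) =>
      Real.exp (-(‖phasorSum p.1 p.2‖ ^ 2 / Ω)) := by
    unfold phasorSum
    fun_prop
  exact h.stronglyMeasurable.integral_prod_right'.measurable

/-! ### The law of the envelope. -/

section Model

variable {S : Type*} [MeasurableSpace S] {μ : Measure S} {N : ℕ} {Ω : ℝ}
  {V : Fin N → ℝ} {φ : Fin N → S → ℝ} {Vd φd : S → ℝ}

/-- Otherwise the push-forward would be zero by convention, unlike the uniform law on a set of
positive finite measure. -/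
lemma aemeasurable_of_isUniform_phase {X : S → ℝ}
    (hX : pdf.IsUniform X (Set.Icc 0 (2 * Real.pi)) μ volume) : AEMeasurable X μ :=
  hX.aemeasurable (by simp [Real.volume_Icc, Real.pi_pos])
    (by rw [Real.volume_Icc]; exact ENNReal.ofReal_ne_top)

lemma IsMWDP.aemeasurable (h : IsMWDP μ Ω V φ Vd φd) (i : Fin N ⊕ Fin 2) :
    AEMeasurable ((Sum.elim φ ![Vd, φd] : Fin N ⊕ Fin 2 → S → ℝ) i) μ := by
  rcases i with i | i
  · exact aemeasurable_of_isUniform_phase (h.phase_uniform i)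
  · fin_cases i
    · exact h.diffuse_magnitude_law.aemeasurable
    · exact aemeasurable_of_isUniform_phase h.diffuse_phase_uniform

/-- The total mass comes from being the law of `Vd`; no integral is computed. -/
lemma isProbabilityMeasure_nakagami [IsProbabilityMeasure μ] (h : IsMWDP μ Ω V φ Vd φd) :
    IsProbabilityMeasure (nakagamiMeasure 1 Ω) :=
  h.diffuse_magnitude_law.map_eq ▸
    Measure.isProbabilityMeasure_map h.diffuse_magnitude_law.aemeasurable

/-- The joint law of the specular phases, the diffuse magnitude and the diffuse phase. -/
lemma IsMWDP.map_eq_prod [IsProbabilityMeasure μ] (h : IsMWDP μ Ω V φ Vd φd) :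
    μ.map (fun s => ((fun i => φ i s), (Vd s, φd s))) =
      (Measure.pi fun _ : Fin N => phaseMeasure).prod
        ((nakagamiMeasure 1 Ω).prod phaseMeasure) := by
  have := isProbabilityMeasure_nakagami h
  let ν : Fin N ⊕ Fin 2 → Measure ℝ :=
    Sum.elim (fun _ => phaseMeasure) ![nakagamiMeasure 1 Ω, phaseMeasure]
  have hν : ∀ i, IsProbabilityMeasure (ν i) := by
    rintro (i | i)
    · exact inferInstanceAs (IsProbabilityMeasure phaseMeasure)
    · fin_cases i
      · exact this
      · exact inferInstanceAs (IsProbabilityMeasure phaseMeasure)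
  have hlaw : ∀ i, μ.map ((Sum.elim φ ![Vd, φd] : Fin N ⊕ Fin 2 → S → ℝ) i) = ν i := by
    rintro (i | i)
    · exact h.phase_uniform i
    · fin_cases i
      · exact h.diffuse_magnitude_law.map_eq
      · exact h.diffuse_phase_uniform
  have hjoint := (iIndepFun_iff_map_fun_eq_pi_map h.aemeasurable).1 h.independent
  simp_rw [hlaw] at hjoint
  have h1 := measurePreserving_sumPiEquivProdPi ν
  -- Independence gives a product measure over `Fin N ⊕ Fin 2`; `h1` splits the sum index and `h2`
  -- turns the `Fin 2` factor into a pair.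
  have h2 := (MeasurePreserving.id (Measure.pi fun i => ν (Sum.inl i))).prod
    (measurePreserving_piFinTwo fun i => ν (Sum.inr i))
  have h3 := (h2.comp h1).map_eq
  rw [← hjoint, AEMeasurable.map_map_of_aemeasurable (h2.comp h1).measurable.aemeasurable
    (aemeasurable_pi_lambda _ h.aemeasurable)] at h3
  exact h3

lemma IsMWDP.lintegral_envelope [IsProbabilityMeasure μ] (h : IsMWDP μ Ω V φ Vd φd) {g : ℝ → ENNReal}
    (hg : Measurable g) :
    ∫⁻ s, g (envelope V φ Vd φd s) ∂μ = ∫⁻ r in Set.Ioi (0 : ℝ),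
      ENNReal.ofReal (2 * r / Ω * psi2 1 (psi2Params N 1) (psi2Args Ω V r)) * g r := by
  have := isProbabilityMeasure_nakagami h
  have hΩ : 0 < Ω := h.spread_pos
  have hS := (continuous_phasorSum V).measurable
  let G : (Fin N → ℝ) × ℝ × ℝ → ENNReal := fun p =>
    g ‖phasorSum V p.1 + p.2.1 * Complex.exp (Complex.I * p.2.2)‖
  have hG : Measurable G := by fun_prop
  have hX : AEMeasurable (fun s => ((fun i => φ i s), (Vd s, φd s))) μ :=
    (aemeasurable_pi_lambda _ fun i => h.aemeasurable (Sum.inl i)).prodMk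
      ((h.aemeasurable (Sum.inr 0)).prodMk (h.aemeasurable (Sum.inr 1)))
  calc ∫⁻ s, g (envelope V φ Vd φd s) ∂μ
      = ∫⁻ p, G p ∂μ.map (fun s => ((fun i => φ i s), (Vd s, φd s))) :=
        (lintegral_map' hG.aemeasurable hX).symm
    _ = ∫⁻ θ, ∫⁻ v, ∫⁻ α, G (θ, v, α)
          ∂phaseMeasure ∂nakagamiMeasure 1 Ω ∂Measure.pi (fun _ : Fin N => phaseMeasure) := by
        rw [h.map_eq_prod, lintegral_prod _ hG.aemeasurable]
        refine lintegral_congr fun θ => ?_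
        exact lintegral_prod _ (hG.comp measurable_prodMk_left).aemeasurable
    _ = _ := by
        rw [lintegral_norm_phasorSum_add hΩ V hg]
        refine setLIntegral_congr_fun measurableSet_Ioi fun r hr => ?_
        have hr : 0 < r := hr
        rw [lintegral_complexGaussianPDFReal_phase hΩ, ← ENNReal.ofReal_mul (by positivity)]
        congr 2
        field_simp

lemma IsMWDP.aemeasurable_envelope (h : IsMWDP μ Ω V φ Vd φd) :
    AEMeasurable (envelope V φ Vd φd) μ := by
  have h1 : ∀ i, AEMeasurable (φ i) μ := fun i => h.aemeasurable (Sum.inl i)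
  have h2 : AEMeasurable Vd μ := h.aemeasurable (Sum.inr 0)
  have h3 : AEMeasurable φd μ := h.aemeasurable (Sum.inr 1)
  unfold envelope receivedSignal
  fun_prop

/-- The density of the envelope. -/
noncomputable def envelopePDF (Ω : ℝ) (V : Fin N → ℝ) (r : ℝ) : ENNReal :=
  if 0 ≤ r then ENNReal.ofReal (2 * r / Ω * psi2 1 (psi2Params N 1) (psi2Args Ω V r)) else 0

lemma measurable_mul_psi2 (Ω : ℝ) (V : Fin N → ℝ) :
    Measurable fun r => 2 * r / Ω * psi2 1 (psi2Params N 1) (psi2Args Ω V r) := by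
  have h := (measurable_psi2_one_one (n := N + 1) Ω).comp
    (f := fun r : ℝ => (Fin.snoc V (-r) : Fin (N + 1) → ℝ)) (by
      refine measurable_pi_lambda _ fun j => ?_
      refine Fin.lastCases ?_ (fun i => ?_) j
      · simp only [Fin.snoc_last]
        fun_prop
      · simp only [Fin.snoc_castSucc]
        fun_prop)
  simp_rw [psi2Params_one, psi2Args_eq]
  exact Measurable.mul (by fun_prop) h

lemma measurable_envelopePDF (Ω : ℝ) (V : Fin N → ℝ) : Measurable (envelopePDF Ω V) :=
  Measurable.ite measurableSet_Ici
    (measurable_mul_psi2 Ω V).ennreal_ofReal measurable_const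

lemma IsMWDP.map_envelope [IsProbabilityMeasure μ] (h : IsMWDP μ Ω V φ Vd φd) :
    μ.map (envelope V φ Vd φd) = volume.withDensity (envelopePDF Ω V) := by
  ext A hA
  rw [withDensity_apply _ hA, Measure.map_apply_of_aemeasurable h.aemeasurable_envelope hA]
  -- Indicator test functions turn the formula for expectations into one for measures.
  have h1 := h.lintegral_envelope (g := A.indicator 1) (measurable_one.indicator hA)
  have h2 : ∀ s, A.indicator (1 : ℝ → ENNReal) (envelope V φ Vd φd s) =
      (envelope V φ Vd φd ⁻¹' A).indicator 1 s := fun s => rfl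
  simp_rw [h2] at h1
  rw [lintegral_indicator_one₀ (h.aemeasurable_envelope.nullMeasurableSet_preimage hA)] at h1
  rw [h1, ← lintegral_indicator hA, setLIntegral_congr Ioi_ae_eq_Ici,
    ← lintegral_indicator measurableSet_Ici]
  refine lintegral_congr fun r => ?_
  by_cases hr : 0 ≤ r <;> by_cases hrA : r ∈ A <;> simp [envelopePDF, hr, hrA]

lemma IsMWDP.cdf_envelope [IsProbabilityMeasure μ] (h : IsMWDP μ Ω V φ Vd φd) {t : ℝ} (ht : 0 ≤ t) :
    cdf (μ.map (envelope V φ Vd φd)) t =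
      t ^ 2 / Ω * psi2 1 (psi2Params N 2) (psi2Args Ω V t) := by
  have hΩ : 0 < Ω := h.spread_pos
  have := Measure.isProbabilityMeasure_map h.aemeasurable_envelope
  have hmeas := measurable_mul_psi2 Ω V
  rw [cdf_eq_real, ← integral_mul_psi2 Ω V ht, measureReal_def, h.map_envelope,
    withDensity_apply _ measurableSet_Iic, intervalIntegral.integral_of_le ht,
    ← integral_Icc_eq_integral_Ioc, integral_eq_lintegral_of_nonneg_ae]
  · congr 1
    -- The half-line up to `t` reduces to `[0, t]` because `envelopePDF` vanishes at negative
    -- arguments.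
    rw [← lintegral_indicator measurableSet_Iic, ← lintegral_indicator measurableSet_Icc]
    refine lintegral_congr fun r => ?_
    by_cases h0 : 0 ≤ r <;> by_cases h1 : r ≤ t <;> simp [envelopePDF, h0, h1, Set.indicator]
  · refine (ae_restrict_iff' measurableSet_Icc).2 (Filter.Eventually.of_forall fun r hr => ?_)
    have := psi2_params_one_nonneg Ω V r
    have := hr.1
    simp only [Pi.zero_apply]
    positivity
  · exact hmeas.aestronglyMeasurable

end Model

theorem corollary2 {S : Type*} [MeasurableSpace S] (μ : Measure S) [IsProbabilityMeasure μ]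
    {N : ℕ} (Ω : ℝ) (V : Fin N → ℝ) (φ : Fin N → S → ℝ) (Vd φd : S → ℝ)
    (hmodel : IsMWDP μ Ω V φ Vd φd) :
    (∀ t : ℝ, Summable (psi2Term 1 (psi2Params N 1) (psi2Args Ω V t)) ∧
      Summable (psi2Term 1 (psi2Params N 2) (psi2Args Ω V t))) ∧
    (∀ r : ℝ, 0 ≤ r → 0 ≤ 2 * r / Ω * psi2 1 (psi2Params N 1) (psi2Args Ω V r)) ∧
    HasPDF (envelope V φ Vd φd) μ volume ∧
    (pdf (envelope V φ Vd φd) μ volume =ᵐ[volume] fun r =>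
      if 0 ≤ r then
        ENNReal.ofReal (2 * r / Ω * psi2 1 (psi2Params N 1) (psi2Args Ω V r))
      else 0) ∧
    (∀ t : ℝ, 0 ≤ t →
      cdf (μ.map (envelope V φ Vd φd)) t =
        t ^ 2 / Ω * psi2 1 (psi2Params N 2) (psi2Args Ω V t)) := by
  have hmeas := measurable_envelopePDF Ω V
  have hpdf : HasPDF (envelope V φ Vd φd) μ volume :=
    hasPDF_of_map_eq_withDensity hmodel.aemeasurable_envelope _ hmeas.aemeasurable
      hmodel.map_envelope
  refine ⟨fun t => ⟨summable_psi2Term_params_one Ω V t, summable_psi2Term_params_two Ω V t⟩,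
    fun r hr => ?_, hpdf, ?_, fun t ht => hmodel.cdf_envelope ht⟩
  · have hΩ : 0 < Ω := hmodel.spread_pos
    have := psi2_params_one_nonneg Ω V r
    positivity
  · exact (pdf.eq_of_map_eq_withDensity _ hmeas.aemeasurable).1 hmodel.map_envelope
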